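/- \textbf{Theorem.} Let $G$ be a finite connected multigraph without loops (parallel edges are allowed), let $\Gamma$ be the metric graph obtained from $G$ by giving every edge length $1$, and let $D=\sum_{v\in V(G)}D(v)\,(v)$, $D(v)\in\mathbb{Z}$, be a divisor on $G$, regarded also as a divisor on $\Gamma$. Then $$r_G(D)=r_\Gamma(D).$$ Here a divisor on $G$ (respectively on $\Gamma$) is an element of the free abelian group on the vertices of $G$ (respectively on the points of $\Gamma$); its degree $\deg$ is the sum of its coefficients, and it is effective, written $\ge 0$, if all its coefficients are nonnegative. Two divisors on $G$ are equivalent if their difference equals $\sum_{v}\sum_{e=vw\in E(G)}(f(v)-f(w))\,(v)$ for some $f:V(G)\to\mathbb{Z}$. A rational function on $\Gamma$ is a continuous function $f:\Gamma\to\mathbb{R}$ which on every edge is piecewise linear with integral slopes and finitely many linear parts; $\operatorname{ord}_f p$ denotes the sum of the outgoing slopes of $f$ at the point $p$. Two divisors on $\Gamma$ are equivalent if their difference equals $\sum_{p\in\Gamma}\operatorname{ord}_f(p)\,(p)$ for some rational function $f$. On $G$ as on $\Gamma$, $|D|$ denotes the set of effective divisors equivalent to $D$, and the rank is $$r(D)=\min\{\deg(E)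 : E\ge 0,\ |D-E|=\emptyset\}-1 ,$$ where $E$ ranges over the divisors on $G$, respectively on $\Gamma$ (in both cases the minimum is over a nonempty set). -/

import Mathlib

/-! ### Divisors, linear systems and rank for a given linear equivalence -/

/-- The free abelian group on a set `X`. -/
abbrev Divisor (X : Type*) := X →₀ ℤ

namespace Divisor

variable {X : Type*}

/-- The degree, i.e. the sum of all coefficients. -/
def deg (D : Divisor X) : ℤ := D.sum fun _ n => n

/-- `|D|`: the effective divisors equivalent to `D` (`0 ≤ E` is the pointwise order). -/
def linearSystem (equiv : Divisor X → Divisor X → Prop) (D : Divisor X) : Set (Divisor X) :=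
  {E | 0 ≤ E ∧ equiv E D}

/-- The degrees of the effective divisors `E` with `|D - E| = ∅`. -/
def emptyingDegrees (equiv : Divisor X → Divisor X → Prop) (D : Divisor X) : Set ℤ :=
  {n | ∃ E : Divisor X, 0 ≤ E ∧ linearSystem equiv (D - E) = ∅ ∧ deg E = n}

/-- `r(D) = min {deg E : E ≥ 0, |D - E| = ∅} - 1`. The set consists of nonnegative integers, so
that `sInf` is its minimum as soon as it is nonempty. -/
noncomputable def rank (equiv : Divisor X → Divisor X → Prop) (D : Divisor X) : ℤ :=
  sInf (emptyingDegrees equiv D) - 1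

end Divisor

/-! ### Multigraphs -/

/-- A multigraph, loops and parallel edges allowed, with vertex set `V` and edge set `E`. The
edge `e` joins `src e` and `tgt e`; which end is called `src` is an arbitrary choice, used only to
parametrize edges by intervals. -/
structure Multigraph (V E : Type*) where
  src : E → V
  tgt : E → V

namespace Multigraph

variable {V E : Type*}

/-- The graph is connected (in particular nonempty); `SimpleGraph.fromRel` symmetrizes the
relation and discards loops. -/
def Connected (G : Multigraph V E) : Prop :=
  (SimpleGraph.fromRel fun v w => ∃ e, G.src e = v ∧ G.tgt e = w).Connected

def Loopless (G : Multigraph V E) : Prop :=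
  ∀ e, G.src e ≠ G.tgt e

open Classical in
/-- The coefficient at `v` of the divisor associated to `f : V → ℤ`: the sum of `f v - f w` over
the edges `e = vw`. -/
noncomputable def divAt [Fintype E] (G : Multigraph V E) (f : V → ℤ) (v : V) : ℤ :=
  ∑ e, ((if G.src e = v then f v - f (G.tgt e) else 0) +
    (if G.tgt e = v then f v - f (G.src e) else 0))

/-- Linear equivalence: `D - D'` is the divisor associated to a function `f : V → ℤ`. -/
def LinEquiv [Fintype E] (G : Multigraph V E) (D D' : Divisor V) : Prop :=
  ∃ f : V → ℤ, ∀ v, (D - D') v = G.divAt f v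

/-- The rank `r_G(D)`. -/
noncomputable def rank [Fintype E] (G : Multigraph V E) (D : Divisor V) : ℤ :=
  Divisor.rank G.LinEquiv D

end Multigraph

/-! ### Metric graphs -/

/-- A metric graph: a multigraph whose edges have positive lengths. -/
structure MetricGraph (V E : Type*) extends Multigraph V E where
  len : E → ℝ
  len_pos : ∀ e, 0 < len e

namespace MetricGraph

variable {V E : Type*}

/-- The points of a metric graph: its vertices, and the interior points of the intervals
`[0, len e]`, whose ends `0` and `len e` are identified with `src e` and `tgt e`. -/
inductive Point (Γ : MetricGraph V E) where
  | vertex (v : V) : Point Γ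
  | inner (e : E) (t : Set.Ioo (0 : ℝ) (Γ.len e)) : Point Γ

open Classical in
/-- The parametrization of the edge `e` by `[0, len e]`, extended constantly to the left of `0`
and to the right of `len e`. -/
noncomputable def param (Γ : MetricGraph V E) (e : E) (t : ℝ) : Γ.Point :=
  if h : t ∈ Set.Ioo 0 (Γ.len e) then .inner e ⟨t, h⟩
  else if t ≤ 0 then .vertex (Γ.src e) else .vertex (Γ.tgt e)

/-- The topology glued from the edges: a set of points is open if and only if its preimage in each
interval `[0, len e]` is open. -/
noncomputable instance (Γ : MetricGraph V E) : TopologicalSpace Γ.Point :=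
  ⨆ e : E, TopologicalSpace.coinduced
    (fun t : Set.Icc (0 : ℝ) (Γ.len e) => Γ.param e t) inferInstance

/-- `g` is piecewise linear on `[0, l]` with integral slopes and finitely many linear parts: off a
finite set `S` of break points, `g` is linear with an integral slope. -/
def IsIntegralPL (l : ℝ) (g : ℝ → ℝ) : Prop :=
  ∃ S : Finset ℝ, ∀ x y : ℝ, 0 ≤ x → x < y → y ≤ l → (∀ s ∈ S, s ∉ Set.Ioo x y) →
    ∃ m : ℤ, ∀ t ∈ Set.Icc x y, g t = g x + m * (t - x)

/-- Rational functions on a metric graph. -/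
def IsRational (Γ : MetricGraph V E) (f : Γ.Point → ℝ) : Prop :=
  Continuous f ∧ ∀ e, IsIntegralPL (Γ.len e) (fun t => f (Γ.param e t))

/-- The outgoing slope of `f` along `e` in the direction from `src e` to `tgt e`, at the point
with parameter `t`. -/
noncomputable def slopeFwd (Γ : MetricGraph V E) (f : Γ.Point → ℝ) (e : E) (t : ℝ) : ℝ :=
  derivWithin (fun s => f (Γ.param e s)) (Set.Ioi t) t

/-- The outgoing slope of `f` along `e` in the direction from `tgt e` to `src e`, at the point
with parameter `t`. -/
noncomputable def slopeBwd (Γ : MetricGraph V E) (f : Γ.Point → ℝ) (e : E) (t : ℝ) : ℝ :=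
  - derivWithin (fun s => f (Γ.param e s)) (Set.Iio t) t

open Classical in
/-- The order of `f` at a point: the sum of the outgoing slopes of `f` over all the segments
emanating from it. -/
noncomputable def ord [Fintype E] (Γ : MetricGraph V E) (f : Γ.Point → ℝ) : Γ.Point → ℝ
  | .vertex v => ∑ e, ((if Γ.src e = v then Γ.slopeFwd f e 0 else 0) +
      (if Γ.tgt e = v then Γ.slopeBwd f e (Γ.len e) else 0))
  | .inner e t => Γ.slopeFwd f e t + Γ.slopeBwd f e t

/-- Linear equivalence: `D = D' + D_f` for a rational function `f`. -/
def LinEquiv [Fintype E] (Γ : MetricGraph V E) (D D' : Divisor Γ.Point) : Prop :=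
  ∃ f : Γ.Point → ℝ, Γ.IsRational f ∧ ∀ p, (D p : ℝ) = D' p + Γ.ord f p

/-- The rank `r_Γ(D)`. -/
noncomputable def rank [Fintype E] (Γ : MetricGraph V E) (D : Divisor Γ.Point) : ℤ :=
  Divisor.rank Γ.LinEquiv D

end MetricGraph

namespace Multigraph

variable {V E : Type*}

/-- The metric graph corresponding to `G`: all edges have length one. -/
def toMetricGraph (G : Multigraph V E) : MetricGraph V E where
  toMultigraph := G
  len _ := 1
  len_pos _ := one_pos

/-- A divisor on `G`, regarded as a divisor on the corresponding metric graph. -/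
noncomputable def toMetricDivisor (G : Multigraph V E) (D : Divisor V) :
    Divisor G.toMetricGraph.Point :=
  D.mapDomain MetricGraph.Point.vertex

end Multigraph

/-! Call `f` a section of `D` if `D + div f ≥ 0`; then `|D|` is nonempty exactly when `D` has a
section. Two facts give the theorem.

Rounding (`linearSystem_toMetricDivisor_nonempty_iff`): for `D` supported at the vertices, sections
exist on `Γ` if and only if they exist on `G`. A section on `Γ` is convex on each edge, so an
outgoing slope at a vertex is an integer bounded by the difference of the end values. It is then
also bounded by the difference of their floors. Conversely, a function on the vertices is
interpolated linearly.

Vertices determine the rank (`linearSystem_sub_nonempty_of_vertices`): if `D - F` has a section for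
every effective `F` of degree `n` supported at vertices, it has one for every effective `F` of
degree `n` on `Γ`. The core is `exists_section_inner`. Given sections with chips at the two ends of
an edge, add a constant so that they agree at an inner point `p`. Their maximum has chips at the
first and the last point of the edge where the two agree. These points enclose `p`, and moving both
chips inwards by the same distance brings one to `p`.

Consequently the same degrees of `E` occur on both sides, and so the same minimum. -/

open Filter Topology

/-! ### Outgoing slopes and integral piecewise linear functions on an interval -/

namespace MetricGraph

/-- The function `g` is linear with slope `m` on a segment emanating from `x` in the direction
`σ = ±1`; the slope is the outgoing one. -/
def HasOutSlope (σ : ℝ) (g : ℝ → ℝ) (x m : ℝ) : Prop :=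
  ∀ᶠ t in 𝓝[>] (0 : ℝ), g (x + σ * t) = g x + m * t

/-- The direction `σ` at the point `x` of `[0, l]` points into the interval. -/
def Inward (l σ x : ℝ) : Prop :=
  (σ = 1 ∧ 0 ≤ x ∧ x < l) ∨ (σ = -1 ∧ 0 < x ∧ x ≤ l)

theorem eventually_lt_nhdsGT_zero {ε : ℝ} (hε : 0 < ε) : ∀ᶠ t in 𝓝[>] (0 : ℝ), 0 < t ∧ t < ε :=
  Ioo_mem_nhdsGT hε

theorem Inward.eventually_mem {l σ x : ℝ} (h : Inward l σ x) :
    ∀ᶠ t in 𝓝[>] (0 : ℝ), x + σ * t ∈ Set.Icc 0 l := by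
  rcases h with ⟨rfl, h0, hl⟩ | ⟨rfl, h0, hl⟩
  · filter_upwards [eventually_lt_nhdsGT_zero (sub_pos.2 hl)] with t ht
    constructor <;> linarith [ht.1, ht.2]
  · filter_upwards [eventually_lt_nhdsGT_zero h0] with t ht
    constructor <;> linarith [ht.1, ht.2]

theorem Inward.mem {l σ x : ℝ} (h : Inward l σ x) : x ∈ Set.Icc 0 l := by
  rcases h with ⟨-, h0, hl⟩ | ⟨-, h0, hl⟩
  · exact ⟨h0, hl.le⟩
  · exact ⟨h0.le, hl⟩

namespace HasOutSlope

variable {σ x m n l : ℝ} {g h : ℝ → ℝ}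

/-- An inward segment stays in `[0, l]` near `x`, so the constant extension of `param` beyond an
edge does no harm. -/
theorem congr (hg : HasOutSlope σ g x m) (hin : Inward l σ x)
    (hgh : ∀ t ∈ Set.Icc 0 l, g t = h t) : HasOutSlope σ h x m := by
  filter_upwards [hg, hin.eventually_mem] with t ht hmem
  rw [← hgh _ hmem, ← hgh _ hin.mem, ht]

theorem add (hg : HasOutSlope σ g x m) (hh : HasOutSlope σ h x n) :
    HasOutSlope σ (fun t => g t + h t) x (m + n) := by
  filter_upwards [hg, hh] with t h1 h2
  rw [h1, h2]; ring

theorem neg (hg : HasOutSlope σ g x m) : HasOutSlope σ (fun t => - g t) x (-m) := by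
  filter_upwards [hg] with t h1
  rw [h1]; ring

theorem sub (hg : HasOutSlope σ g x m) (hh : HasOutSlope σ h x n) :
    HasOutSlope σ (fun t => g t - h t) x (m - n) := by
  filter_upwards [hg, hh] with t h1 h2
  rw [h1, h2]; ring

theorem affine (σ x m c : ℝ) : HasOutSlope σ (fun t => m * t + c) x (σ * m) :=
  Eventually.of_forall fun t => by ring

theorem const (σ x c : ℝ) : HasOutSlope σ (fun _ => c) x 0 :=
  Eventually.of_forall fun t => by ring

theorem le_of_eventually_le (hg : HasOutSlope σ g x m)
    (h : ∀ᶠ t in 𝓝[>] (0 : ℝ), g x + n * t ≤ g (x + σ * t)) : n ≤ m := by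
  obtain ⟨t, ht, hle, hpos⟩ := (hg.and (h.and self_mem_nhdsWithin)).exists
  rw [ht] at hle
  exact le_of_mul_le_mul_right (by linarith) (show (0 : ℝ) < t from hpos)

theorem ge_of_eventually_ge (hg : HasOutSlope σ g x m)
    (h : ∀ᶠ t in 𝓝[>] (0 : ℝ), g (x + σ * t) ≤ g x + n * t) : m ≤ n := by
  obtain ⟨t, ht, hle, hpos⟩ := (hg.and (h.and self_mem_nhdsWithin)).exists
  rw [ht] at hle
  exact le_of_mul_le_mul_right (by linarith) (show (0 : ℝ) < t from hpos)

theorem max_of_lt (hg : HasOutSlope σ g x m) (hh : HasOutSlope σ h x n) (hlt : h x < g x) :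
    HasOutSlope σ (fun t => max (g t) (h t)) x m := by
  -- The gap `g - h` shrinks at rate at most `|n - m|`; the added `1` keeps the denominator
  -- positive.
  have hpos : 0 < (g x - h x) / (1 + |n - m|) := by
    have := abs_nonneg (n - m)
    have := sub_pos.2 hlt
    positivity
  filter_upwards [hg, hh, eventually_lt_nhdsGT_zero hpos] with t h1 h2 ht
  have hlt' := (lt_div_iff₀ (by linarith [abs_nonneg (n - m)])).1 ht.2
  have : (n - m) * t ≤ |n - m| * t := mul_le_mul_of_nonneg_right (le_abs_self _) ht.1.le
  rw [h1, h2, max_eq_left hlt.le, max_eq_left]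
  linarith [ht.1]

theorem max_of_eq (hg : HasOutSlope σ g x m) (hh : HasOutSlope σ h x n) (heq : g x = h x) :
    HasOutSlope σ (fun t => max (g t) (h t)) x (max m n) := by
  filter_upwards [hg, hh, eventually_lt_nhdsGT_zero one_pos] with t h1 h2 ht
  rw [h1, h2, heq, max_self, max_add_add_left, max_mul_of_nonneg _ _ ht.1.le]

theorem hasDerivWithinAt_Ioi (hg : HasOutSlope 1 g x m) :
    HasDerivWithinAt g m (Set.Ioi x) x := by
  have hlin : HasDerivWithinAt (fun t => g x + m * (t - x)) m (Set.Ioi x) x := by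
    simpa using (((hasDerivAt_id x).sub_const x).const_mul m |>.const_add (g x)).hasDerivWithinAt
  refine hlin.congr_of_eventuallyEq ?_ (by simp)
  have htend : Tendsto (fun t : ℝ => t - x) (𝓝[>] x) (𝓝[>] 0) := by
    refine tendsto_nhdsWithin_iff.2 ⟨?_, ?_⟩
    · exact ((continuous_id.sub continuous_const).tendsto' x 0 (by simp)).mono_left
        nhdsWithin_le_nhds
    · filter_upwards [self_mem_nhdsWithin] with t ht using sub_pos.2 (by simpa using ht)
  filter_upwards [htend.eventually hg] with t ht
  simpa using ht

theorem hasDerivWithinAt_Iio (hg : HasOutSlope (-1) g x m) :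
    HasDerivWithinAt g (-m) (Set.Iio x) x := by
  have hlin : HasDerivWithinAt (fun t => g x + -m * (t - x)) (-m) (Set.Iio x) x := by
    simpa using
      (((hasDerivAt_id x).sub_const x).const_mul (-m) |>.const_add (g x)).hasDerivWithinAt
  refine hlin.congr_of_eventuallyEq ?_ (by simp)
  have htend : Tendsto (fun t : ℝ => x - t) (𝓝[<] x) (𝓝[>] 0) := by
    refine tendsto_nhdsWithin_iff.2 ⟨?_, ?_⟩
    · exact ((continuous_const.sub continuous_id).tendsto' x 0 (by simp)).mono_left
        nhdsWithin_le_nhds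
    · filter_upwards [self_mem_nhdsWithin] with t ht using sub_pos.2 (by simpa using ht)
  filter_upwards [htend.eventually hg] with t ht
  have h1 : x + -1 * (x - t) = t := by ring
  rw [h1] at ht
  rw [ht]; ring

end HasOutSlope

/-- Finitely many break points cannot accumulate at `x`, so a short segment on the given side is
free of them. -/
theorem IsIntegralPL.exists_hasOutSlope {l σ x : ℝ} {g : ℝ → ℝ} (hg : IsIntegralPL l g)
    (hin : Inward l σ x) : ∃ m : ℤ, HasOutSlope σ g x m := by
  obtain ⟨S, hS⟩ := hg
  rcases hin with ⟨rfl, h0, hl⟩ | ⟨rfl, h0, hl⟩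
  · have hfree : ∀ᶠ y in 𝓝[>] x, ∀ s ∈ S, s ∉ Set.Ioo x y := by
      rw [Filter.eventually_all_finset]
      intro s _
      rcases le_or_gt s x with hsx | hsx
      · exact Eventually.of_forall fun y hy => absurd hy.1 hsx.not_gt
      · filter_upwards [Ioo_mem_nhdsGT hsx] with y hy hs using absurd hs.2 hy.2.not_gt
    obtain ⟨y, hy, hxy⟩ := (hfree.and (Ioo_mem_nhdsGT hl)).exists
    obtain ⟨m, hm⟩ := hS x y h0 hxy.1 hxy.2.le hy
    refine ⟨m, ?_⟩
    filter_upwards [eventually_lt_nhdsGT_zero (sub_pos.2 hxy.1)] with t ht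
    rw [hm _ ⟨by linarith [ht.1], by linarith [ht.2]⟩]; ring
  · have hfree : ∀ᶠ y in 𝓝[<] x, ∀ s ∈ S, s ∉ Set.Ioo y x := by
      rw [Filter.eventually_all_finset]
      intro s _
      rcases le_or_gt x s with hsx | hsx
      · exact Eventually.of_forall fun y hy => absurd hy.2 hsx.not_gt
      · filter_upwards [Ioo_mem_nhdsLT hsx] with y hy hs using absurd hs.1 hy.1.not_gt
    obtain ⟨y, hy, hxy⟩ := (hfree.and (Ioo_mem_nhdsLT h0)).exists
    obtain ⟨m, hm⟩ := hS y x hxy.1.le hxy.2 hl hy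
    refine ⟨-m, ?_⟩
    filter_upwards [eventually_lt_nhdsGT_zero (sub_pos.2 hxy.2)] with t ht
    rw [hm _ ⟨by linarith [ht.2], by linarith [ht.1]⟩, hm x ⟨hxy.2.le, le_rfl⟩]
    push_cast; ring

theorem IsIntegralPL.glue {y z : ℝ} {g : ℝ → ℝ} (hg : IsIntegralPL y g) (m : ℤ)
    (hm : ∀ t ∈ Set.Icc y z, g t = g y + m * (t - y)) : IsIntegralPL z g := by
  classical
  obtain ⟨S, hS⟩ := hg
  refine ⟨insert y S, fun x x' h0 hxx' hz hfree => ?_⟩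
  have hy := hfree y (Finset.mem_insert_self _ _)
  rcases le_or_gt x' y with h1 | h1
  · exact hS x x' h0 hxx' h1 fun s hs => hfree s (Finset.mem_insert_of_mem hs)
  · have h2 : y ≤ x := by
      by_contra! hlt
      exact hy ⟨hlt, h1⟩
    refine ⟨m, fun t ht => ?_⟩
    rw [hm t ⟨h2.trans ht.1, ht.2.trans hz⟩, hm x ⟨h2, hxx'.le.trans hz⟩]; ring

/-- Compactness turns one-sided linearity into finitely many pieces. Let `c` be the supremum of the
`y` such that `g` is piecewise linear on `[0, y]`: the backward slope at `c` shows that `c` is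
attained, and the forward slope leads past `c` unless `c = l`. Closure under sums and maxima thereby
reduces to slopes at one point, with no bookkeeping of break points. -/
theorem isIntegralPL_of_hasOutSlope {l : ℝ} (hl : 0 ≤ l) {g : ℝ → ℝ}
    (hg : ∀ σ x, Inward l σ x → ∃ m : ℤ, HasOutSlope σ g x m) : IsIntegralPL l g := by
  set A : Set ℝ := {y | y ∈ Set.Icc 0 l ∧ IsIntegralPL y g} with hA
  have h0A : (0 : ℝ) ∈ A :=
    ⟨⟨le_rfl, hl⟩, ∅, fun x y hx hxy hy => absurd (hx.trans_lt hxy) hy.not_gt⟩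
  have hbdd : BddAbove A := ⟨l, fun y hy => hy.1.2⟩
  set c := sSup A with hc
  have hc0 : 0 ≤ c := le_csSup hbdd h0A
  have hcl : c ≤ l := csSup_le ⟨0, h0A⟩ fun y hy => hy.1.2
  have hcA : IsIntegralPL c g := by
    rcases hc0.eq_or_lt with h | h
    · rw [← h]; exact h0A.2
    · obtain ⟨m, hm⟩ := hg (-1) c (Or.inr ⟨rfl, h, hcl⟩)
      obtain ⟨ε, hε, hsub⟩ := mem_nhdsGT_iff_exists_Ioc_subset.1 hm
      have hε : 0 < ε := hε
      obtain ⟨y, hyA, hy⟩ := exists_lt_of_lt_csSup ⟨0, h0A⟩ (show c - ε < sSup A by linarith)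
      have hlin : ∀ t, c - ε ≤ t → t ≤ c → g t = g c + m * (c - t) := by
        intro t h1 h2
        rcases h2.eq_or_lt with rfl | h2
        · ring
        · have := hsub (show c - t ∈ Set.Ioc 0 ε from ⟨by linarith, by linarith⟩)
          simp only [Set.mem_ofPred_eq] at this
          rwa [show c + -1 * (c - t) = t by ring] at this
      refine hyA.2.glue (-m) fun t ht => ?_
      rw [hlin t (hy.le.trans ht.1) ht.2, hlin y hy.le (le_csSup hbdd hyA)]
      push_cast; ring
  rcases hcl.eq_or_lt with h | h
  · rwa [← h]
  · exfalso
    obtain ⟨m, hm⟩ := hg 1 c (Or.inl ⟨rfl, hc0, h⟩)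
    obtain ⟨ε, hε, hsub⟩ := mem_nhdsGT_iff_exists_Ioc_subset.1 hm
    have hε : 0 < ε := hε
    have hlin : ∀ t, c ≤ t → t ≤ c + ε → g t = g c + m * (t - c) := by
      intro t h1 h2
      rcases h1.eq_or_lt with rfl | h1
      · ring
      · have := hsub (show t - c ∈ Set.Ioc 0 ε from ⟨by linarith, by linarith⟩)
        simp only [Set.mem_ofPred_eq] at this
        rwa [show c + 1 * (t - c) = t by ring] at this
    have hmem : min (c + ε) l ∈ A :=
      ⟨⟨le_min (by linarith) hl, min_le_right _ _⟩,
        hcA.glue m fun t ht => hlin t ht.1 (ht.2.trans (min_le_left _ _))⟩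
    have := le_csSup hbdd hmem
    have : c < min (c + ε) l := lt_min (by linarith) h
    linarith

theorem IsIntegralPL.congr {l : ℝ} (hl : 0 ≤ l) {g h : ℝ → ℝ} (hg : IsIntegralPL l g)
    (hgh : ∀ t ∈ Set.Icc 0 l, g t = h t) : IsIntegralPL l h :=
  isIntegralPL_of_hasOutSlope hl fun _ _ hin =>
    let ⟨m, hm⟩ := hg.exists_hasOutSlope hin
    ⟨m, hm.congr hin hgh⟩

theorem IsIntegralPL.add {l : ℝ} (hl : 0 ≤ l) {g h : ℝ → ℝ} (hg : IsIntegralPL l g)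
    (hh : IsIntegralPL l h) : IsIntegralPL l (fun t => g t + h t) :=
  isIntegralPL_of_hasOutSlope hl fun _ _ hin =>
    let ⟨m, hm⟩ := hg.exists_hasOutSlope hin
    let ⟨n, hn⟩ := hh.exists_hasOutSlope hin
    ⟨m + n, by simpa using hm.add hn⟩

theorem IsIntegralPL.neg {l : ℝ} (hl : 0 ≤ l) {g : ℝ → ℝ} (hg : IsIntegralPL l g) :
    IsIntegralPL l (fun t => - g t) :=
  isIntegralPL_of_hasOutSlope hl fun _ _ hin =>
    let ⟨m, hm⟩ := hg.exists_hasOutSlope hin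
    ⟨-m, by simpa using hm.neg⟩

theorem IsIntegralPL.max {l : ℝ} (hl : 0 ≤ l) {g h : ℝ → ℝ} (hg : IsIntegralPL l g)
    (hh : IsIntegralPL l h) : IsIntegralPL l (fun t => max (g t) (h t)) := by
  refine isIntegralPL_of_hasOutSlope hl fun σ x hin => ?_
  obtain ⟨m, hm⟩ := hg.exists_hasOutSlope hin
  obtain ⟨n, hn⟩ := hh.exists_hasOutSlope hin
  rcases lt_trichotomy (g x) (h x) with hlt | heq | hlt
  · exact ⟨n, by simpa only [max_comm] using hn.max_of_lt hm hlt⟩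
  · exact ⟨Max.max m n, by simpa using hm.max_of_eq hn heq⟩
  · exact ⟨m, hm.max_of_lt hn hlt⟩

theorem IsIntegralPL.min {l : ℝ} (hl : 0 ≤ l) {g h : ℝ → ℝ} (hg : IsIntegralPL l g)
    (hh : IsIntegralPL l h) : IsIntegralPL l (fun t => min (g t) (h t)) := by
  simpa [max_neg_neg] using ((hg.neg hl).max hl (hh.neg hl)).neg hl

theorem isIntegralPL_affine (l : ℝ) (m : ℤ) (c : ℝ) : IsIntegralPL l (fun t => m * t + c) :=
  ⟨∅, fun x y _ _ _ _ => ⟨m, fun t _ => by ring⟩⟩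

theorem IsIntegralPL.continuousOn {l : ℝ} {g : ℝ → ℝ} (hg : IsIntegralPL l g) :
    ContinuousOn g (Set.Icc 0 l) := by
  intro x hx
  have hright : ContinuousWithinAt g (Set.Icc x l) x := by
    rcases hx.2.eq_or_lt with h | h
    · rw [h]; simp
    · obtain ⟨m, hm⟩ := hg.exists_hasOutSlope (Or.inl ⟨rfl, hx.1, h⟩)
      exact (hm.hasDerivWithinAt_Ioi.Ici_of_Ioi.continuousWithinAt).mono fun t ht => ht.1
  have hleft : ContinuousWithinAt g (Set.Icc 0 x) x := by
    rcases hx.1.eq_or_lt with h | h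
    · rw [← h]; simp
    · obtain ⟨m, hm⟩ := hg.exists_hasOutSlope (Or.inr ⟨rfl, h, hx.2⟩)
      exact (hm.hasDerivWithinAt_Iio.Iic_of_Iio.continuousWithinAt).mono fun t ht => ht.2
  rw [← Set.Icc_union_Icc_eq_Icc hx.1 hx.2]
  exact hleft.union hright

end MetricGraph

/-! ### Rational functions and their orders -/

namespace MetricGraph

variable {V E : Type*} {Γ : MetricGraph V E}

theorem param_zero (Γ : MetricGraph V E) (e : E) : Γ.param e 0 = .vertex (Γ.src e) := by
  simp [param]

theorem param_len (Γ : MetricGraph V E) (e : E) : Γ.param e (Γ.len e) = .vertex (Γ.tgt e) := by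
  simp [param, Γ.len_pos e]

theorem param_of_mem (Γ : MetricGraph V E) {e : E} {t : ℝ} (ht : t ∈ Set.Ioo 0 (Γ.len e)) :
    Γ.param e t = .inner e ⟨t, ht⟩ := by
  rw [param, dif_pos ht]

/-- Continuity is automatic: the topology is glued from the edges, and piecewise linear functions
are continuous on closed intervals. -/
theorem isRational_of_isIntegralPL {f : Γ.Point → ℝ}
    (hf : ∀ e, IsIntegralPL (Γ.len e) (fun t => f (Γ.param e t))) : Γ.IsRational f := by
  refine ⟨continuous_iSup_dom.2 fun e => continuous_coinduced_dom.2 ?_, hf⟩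
  exact continuousOn_iff_continuous_domRestrict.1 (hf e).continuousOn

theorem slopeFwd_eq {f : Γ.Point → ℝ} {e : E} {t m : ℝ}
    (h : HasOutSlope 1 (fun s => f (Γ.param e s)) t m) : Γ.slopeFwd f e t = m :=
  h.hasDerivWithinAt_Ioi.derivWithin (uniqueDiffWithinAt_Ioi t)

theorem slopeBwd_eq {f : Γ.Point → ℝ} {e : E} {t m : ℝ}
    (h : HasOutSlope (-1) (fun s => f (Γ.param e s)) t m) : Γ.slopeBwd f e t = m := by
  rw [slopeBwd, h.hasDerivWithinAt_Iio.derivWithin (uniqueDiffWithinAt_Iio t), neg_neg]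

namespace IsRational

variable {f g : Γ.Point → ℝ} {e : E} {t : ℝ}

theorem exists_slopeFwd_eq (hf : Γ.IsRational f) (h0 : 0 ≤ t) (hl : t < Γ.len e) :
    ∃ m : ℤ, Γ.slopeFwd f e t = m ∧ HasOutSlope 1 (fun s => f (Γ.param e s)) t m :=
  let ⟨m, hm⟩ := (hf.2 e).exists_hasOutSlope (Or.inl ⟨rfl, h0, hl⟩)
  ⟨m, slopeFwd_eq hm, hm⟩

theorem exists_slopeBwd_eq (hf : Γ.IsRational f) (h0 : 0 < t) (hl : t ≤ Γ.len e) :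
    ∃ m : ℤ, Γ.slopeBwd f e t = m ∧ HasOutSlope (-1) (fun s => f (Γ.param e s)) t m :=
  let ⟨m, hm⟩ := (hf.2 e).exists_hasOutSlope (Or.inr ⟨rfl, h0, hl⟩)
  ⟨m, slopeBwd_eq hm, hm⟩

theorem hasOutSlope_slopeFwd (hf : Γ.IsRational f) (h0 : 0 ≤ t) (hl : t < Γ.len e) :
    HasOutSlope 1 (fun s => f (Γ.param e s)) t (Γ.slopeFwd f e t) := by
  obtain ⟨m, hm, h⟩ := hf.exists_slopeFwd_eq h0 hl
  rwa [hm]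

theorem hasOutSlope_slopeBwd (hf : Γ.IsRational f) (h0 : 0 < t) (hl : t ≤ Γ.len e) :
    HasOutSlope (-1) (fun s => f (Γ.param e s)) t (Γ.slopeBwd f e t) := by
  obtain ⟨m, hm, h⟩ := hf.exists_slopeBwd_eq h0 hl
  rwa [hm]

theorem add (hf : Γ.IsRational f) (hg : Γ.IsRational g) : Γ.IsRational (fun p => f p + g p) :=
  isRational_of_isIntegralPL fun e => (hf.2 e).add (Γ.len_pos e).le (hg.2 e)

theorem max (hf : Γ.IsRational f) (hg : Γ.IsRational g) :
    Γ.IsRational (fun p => max (f p) (g p)) :=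
  isRational_of_isIntegralPL fun e => (hf.2 e).max (Γ.len_pos e).le (hg.2 e)

theorem add_const (hf : Γ.IsRational f) (c : ℝ) : Γ.IsRational (fun p => f p + c) :=
  isRational_of_isIntegralPL fun e => (hf.2 e).add (Γ.len_pos e).le
    (by simpa using isIntegralPL_affine (Γ.len e) 0 c)

theorem slopeFwd_add (hf : Γ.IsRational f) (hg : Γ.IsRational g) (h0 : 0 ≤ t)
    (hl : t < Γ.len e) :
    Γ.slopeFwd (fun p => f p + g p) e t = Γ.slopeFwd f e t + Γ.slopeFwd g e t :=
  slopeFwd_eq ((hf.hasOutSlope_slopeFwd h0 hl).add (hg.hasOutSlope_slopeFwd h0 hl))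

theorem slopeBwd_add (hf : Γ.IsRational f) (hg : Γ.IsRational g) (h0 : 0 < t)
    (hl : t ≤ Γ.len e) :
    Γ.slopeBwd (fun p => f p + g p) e t = Γ.slopeBwd f e t + Γ.slopeBwd g e t :=
  slopeBwd_eq ((hf.hasOutSlope_slopeBwd h0 hl).add (hg.hasOutSlope_slopeBwd h0 hl))

theorem slopeFwd_le_of_touch (hf : Γ.IsRational f) (hg : Γ.IsRational g) (hle : ∀ p, f p ≤ g p)
    (h0 : 0 ≤ t) (hl : t < Γ.len e) (heq : f (Γ.param e t) = g (Γ.param e t)) :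
    Γ.slopeFwd f e t ≤ Γ.slopeFwd g e t := by
  refine (hg.hasOutSlope_slopeFwd h0 hl).le_of_eventually_le ?_
  filter_upwards [hf.hasOutSlope_slopeFwd h0 hl] with s hs
  rw [← heq, ← hs]
  exact hle _

theorem slopeBwd_le_of_touch (hf : Γ.IsRational f) (hg : Γ.IsRational g) (hle : ∀ p, f p ≤ g p)
    (h0 : 0 < t) (hl : t ≤ Γ.len e) (heq : f (Γ.param e t) = g (Γ.param e t)) :
    Γ.slopeBwd f e t ≤ Γ.slopeBwd g e t := by
  refine (hg.hasOutSlope_slopeBwd h0 hl).le_of_eventually_le ?_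
  filter_upwards [hf.hasOutSlope_slopeBwd h0 hl] with s hs
  rw [← heq, ← hs]
  exact hle _

variable [Fintype E]

theorem ord_add (hf : Γ.IsRational f) (hg : Γ.IsRational g) (p : Γ.Point) :
    Γ.ord (fun p => f p + g p) p = Γ.ord f p + Γ.ord g p := by
  cases p with
  | vertex v =>
    simp only [ord, ← Finset.sum_add_distrib]
    refine Finset.sum_congr rfl fun e _ => ?_
    rw [hf.slopeFwd_add hg le_rfl (Γ.len_pos e), hf.slopeBwd_add hg (Γ.len_pos e) le_rfl]
    split_ifs <;> ring
  | inner e t =>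
    simp only [ord]
    rw [hf.slopeFwd_add hg t.2.1.le t.2.2, hf.slopeBwd_add hg t.2.1 t.2.2.le]
    ring

/-- At a point of contact every outgoing slope of the upper function is at least that of the lower
one. This is why the maximum of two sections is a section. -/
theorem ord_le_of_touch (hf : Γ.IsRational f) (hg : Γ.IsRational g) (hle : ∀ p, f p ≤ g p)
    {p : Γ.Point} (heq : f p = g p) : Γ.ord f p ≤ Γ.ord g p := by
  cases p with
  | vertex v =>
    refine Finset.sum_le_sum fun e _ => add_le_add ?_ ?_
    · split_ifs with h
      · exact hf.slopeFwd_le_of_touch hg hle le_rfl (Γ.len_pos e) (by rwa [param_zero, h])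
      · exact le_rfl
    · split_ifs with h
      · exact hf.slopeBwd_le_of_touch hg hle (Γ.len_pos e) le_rfl (by rwa [param_len, h])
      · exact le_rfl
  | inner e t =>
    have heq' : f (Γ.param e t) = g (Γ.param e t) := by rwa [Γ.param_of_mem t.2]
    exact add_le_add (hf.slopeFwd_le_of_touch hg hle t.2.1.le t.2.2 heq')
      (hf.slopeBwd_le_of_touch hg hle t.2.1 t.2.2.le heq')

theorem ord_add_const (hf : Γ.IsRational f) (c : ℝ) (p : Γ.Point) :
    Γ.ord (fun p => f p + c) p = Γ.ord f p := by
  have hc : Γ.IsRational fun _ => c :=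
    isRational_of_isIntegralPL fun e => by simpa using isIntegralPL_affine (Γ.len e) 0 c
  rw [hf.ord_add hc]
  have hfwd (e : E) (t : ℝ) : Γ.slopeFwd (fun _ => c) e t = 0 := slopeFwd_eq (.const _ _ _)
  have hbwd (e : E) (t : ℝ) : Γ.slopeBwd (fun _ => c) e t = 0 := slopeBwd_eq (.const _ _ _)
  cases p <;> simp [ord, hfwd, hbwd]

theorem exists_ord_eq_intCast (hf : Γ.IsRational f) (p : Γ.Point) :
    ∃ n : ℤ, Γ.ord f p = n := by
  cases p with
  | vertex v =>
    choose m hm _ using fun e => hf.exists_slopeFwd_eq (e := e) le_rfl (Γ.len_pos e)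
    choose n hn _ using fun e => hf.exists_slopeBwd_eq (e := e) (Γ.len_pos e) le_rfl
    classical
    refine ⟨∑ e, ((if Γ.src e = v then m e else 0) + (if Γ.tgt e = v then n e else 0)), ?_⟩
    simp only [ord, hm, hn]
    push_cast
    refine Finset.sum_congr rfl fun e _ => ?_
    split_ifs <;> rfl
  | inner e t =>
    obtain ⟨m, hm, -⟩ := hf.exists_slopeFwd_eq t.2.1.le t.2.2
    obtain ⟨n, hn, -⟩ := hf.exists_slopeBwd_eq t.2.1 t.2.2.le
    exact ⟨m + n, by simp [ord, hm, hn]⟩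

/-- At an inner point that is not a break point the two outgoing slopes cancel. -/
theorem finite_ord_ne_zero [Finite V] (hf : Γ.IsRational f) : {p | Γ.ord f p ≠ 0}.Finite := by
  choose S hS using hf.2
  refine ((Set.finite_range (Point.vertex (Γ := Γ))).union
    (Set.finite_iUnion fun e => (S e).finite_toSet.image (Γ.param e))).subset fun p hp => ?_
  cases p with
  | vertex v => exact Or.inl ⟨v, rfl⟩
  | inner e t =>
    right
    refine Set.mem_iUnion.2 ⟨e, t, ?_, Γ.param_of_mem t.2⟩
    by_contra hts
    obtain ⟨x, y, hxy, hsub⟩ := mem_nhds_iff_exists_Ioo_subset.1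
      ((S e).finite_toSet.isClosed.isOpen_compl.mem_nhds hts)
    have hx : Max.max x 0 < t := max_lt hxy.1 t.2.1
    have hy : (t : ℝ) < Min.min y (Γ.len e) := lt_min hxy.2 t.2.2
    obtain ⟨m, hm⟩ := hS e (Max.max x 0) (Min.min y (Γ.len e)) (le_max_right _ _) (hx.trans hy)
      (min_le_right _ _) fun s hs hmem =>
        hsub ⟨(le_max_left _ _).trans_lt hmem.1, hmem.2.trans_le (min_le_left _ _)⟩ hs
    beta_reduce at hm
    have hmt := hm t ⟨hx.le, hy.le⟩
    have hfwd : Γ.slopeFwd f e t = m := by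
      refine slopeFwd_eq ?_
      filter_upwards [eventually_lt_nhdsGT_zero (sub_pos.2 hy)] with s hs
      rw [hm _ ⟨by linarith [hs.1], by linarith [hs.2]⟩, hmt]; ring
    have hbwd : Γ.slopeBwd f e t = -m := by
      refine slopeBwd_eq ?_
      filter_upwards [eventually_lt_nhdsGT_zero (sub_pos.2 hx)] with s hs
      rw [hm _ ⟨by linarith [hs.2], by linarith [hs.1]⟩, hmt]; ring
    exact hp (by simp [ord, hfwd, hbwd])

/-- The divisor of a rational function. -/
theorem exists_divisor [Finite V] (hf : Γ.IsRational f) :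
    ∃ F : Divisor Γ.Point, ∀ p, (F p : ℝ) = Γ.ord f p := by
  choose n hn using hf.exists_ord_eq_intCast
  refine ⟨Finsupp.ofSupportFinite n (hf.finite_ord_ne_zero.subset fun p hp => ?_),
    fun p => (hn p).symm⟩
  simpa [hn] using hp

end IsRational

/-- Orders are integers and almost all vanish, so a section alone yields the effective divisor; from
here on only inequalities between real orders matter. -/
theorem linearSystem_nonempty_iff [Finite V] [Fintype E] (D : Divisor Γ.Point) :
    (Divisor.linearSystem Γ.LinEquiv D).Nonempty ↔
      ∃ f, Γ.IsRational f ∧ ∀ p, 0 ≤ (D p : ℝ) + Γ.ord f p := by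
  constructor
  · rintro ⟨F, hF, f, hf, h⟩
    exact ⟨f, hf, fun p => by rw [← h p]; exact_mod_cast hF p⟩
  · rintro ⟨f, hf, h⟩
    obtain ⟨F, hF⟩ := hf.exists_divisor
    refine ⟨D + F, fun p => ?_, f, hf, fun p => by simp [hF]⟩
    have := h p
    rw [← hF p] at this
    exact_mod_cast this

/-- The function with prescribed values at the vertices and on the edges. -/
def ofEdges (Γ : MetricGraph V E) (φ : V → ℝ) (ψ : E → ℝ → ℝ) : Γ.Point → ℝ
  | .vertex v => φ v
  | .inner e t => ψ e t

section ofEdges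

variable {φ : V → ℝ} {ψ : E → ℝ → ℝ} {e : E} {t m : ℝ}

theorem ofEdges_param (h0 : ψ e 0 = φ (Γ.src e)) (h1 : ψ e (Γ.len e) = φ (Γ.tgt e))
    (ht : t ∈ Set.Icc 0 (Γ.len e)) : Γ.ofEdges φ ψ (Γ.param e t) = ψ e t := by
  rcases ht.1.eq_or_lt with rfl | hpos
  · rw [param_zero, h0, ofEdges]
  rcases ht.2.eq_or_lt with rfl | hlt
  · rw [param_len, h1, ofEdges]
  · rw [Γ.param_of_mem ⟨hpos, hlt⟩, ofEdges]

theorem isRational_ofEdges (h0 : ∀ e, ψ e 0 = φ (Γ.src e))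
    (h1 : ∀ e, ψ e (Γ.len e) = φ (Γ.tgt e)) (hψ : ∀ e, IsIntegralPL (Γ.len e) (ψ e)) :
    Γ.IsRational (Γ.ofEdges φ ψ) :=
  isRational_of_isIntegralPL fun e => (hψ e).congr (Γ.len_pos e).le
    fun _ ht => (ofEdges_param (h0 e) (h1 e) ht).symm

theorem slopeFwd_ofEdges (h0 : ψ e 0 = φ (Γ.src e)) (h1 : ψ e (Γ.len e) = φ (Γ.tgt e))
    (ht0 : 0 ≤ t) (htl : t < Γ.len e) (hm : HasOutSlope 1 (ψ e) t m) :
    Γ.slopeFwd (Γ.ofEdges φ ψ) e t = m :=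
  slopeFwd_eq (hm.congr (Or.inl ⟨rfl, ht0, htl⟩) fun _ ht => (ofEdges_param h0 h1 ht).symm)

theorem slopeBwd_ofEdges (h0 : ψ e 0 = φ (Γ.src e)) (h1 : ψ e (Γ.len e) = φ (Γ.tgt e))
    (ht0 : 0 < t) (htl : t ≤ Γ.len e) (hm : HasOutSlope (-1) (ψ e) t m) :
    Γ.slopeBwd (Γ.ofEdges φ ψ) e t = m :=
  slopeBwd_eq (hm.congr (Or.inr ⟨rfl, ht0, htl⟩) fun _ ht => (ofEdges_param h0 h1 ht).symm)

end ofEdges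

end MetricGraph

/-! ### Convexity along an edge -/

namespace MetricGraph

variable {V E : Type*} {Γ : MetricGraph V E}

/-- A piecewise linear function whose slopes do not decrease lies above its initial tangent. -/
theorem HasOutSlope.add_mul_le_of_convex {l m : ℝ} {g : ℝ → ℝ} (hl : 0 < l)
    (hc : ContinuousOn g (Set.Icc 0 l)) (hm : HasOutSlope 1 g 0 m)
    (hconv : ∀ x ∈ Set.Ioo 0 l, ∃ r s, HasOutSlope 1 g x r ∧ HasOutSlope (-1) g x s ∧ 0 ≤ r + s) :
    g 0 + m * l ≤ g l := by
  set k : ℝ → ℝ := fun t => g t - (m * t + 0) with hk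
  have hkc : ContinuousOn k (Set.Icc 0 l) := hc.sub (by fun_prop)
  by_contra! hlt
  -- If `g l` lay below the tangent, the last maximum point `x` of `k` would satisfy `x < l`.
  obtain ⟨z, hz, hmax⟩ := isCompact_Icc.exists_isMaxOn (Set.nonempty_Icc.2 hl.le) hkc
  have hK : IsCompact (Set.Icc 0 l ∩ k ⁻¹' {k z}) :=
    isCompact_Icc.of_isClosed_subset
      (hkc.preimage_isClosed_of_isClosed isClosed_Icc isClosed_singleton) Set.inter_subset_left
  obtain ⟨x, ⟨hx, hxz⟩, hgreatest⟩ := hK.exists_isGreatest ⟨z, hz, rfl⟩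
  have hxz : k x = k z := hxz
  have hk0 : k 0 ≤ k z := hmax ⟨le_rfl, hl.le⟩
  have hxl : x < l := by
    refine hx.2.lt_of_ne ?_
    rintro rfl
    simp only [hk] at hk0 hxz
    linarith
  have hright : ∃ r, 0 ≤ r ∧ HasOutSlope 1 k x r := by
    rcases hx.1.eq_or_lt with rfl | hpos
    · exact ⟨m - 1 * m, by simp, hm.sub (.affine 1 0 m 0)⟩
    · obtain ⟨r, s, hr, hs, hrs⟩ := hconv x ⟨hpos, hxl⟩
      have hs' := hs.sub (.affine (-1) x m 0)
      -- At an inner maximum the backward slope is at most `0`, so convexity makes the forward slope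
      -- at least `0`.
      have : s - -1 * m ≤ 0 := by
        refine hs'.ge_of_eventually_ge ?_
        filter_upwards [Inward.eventually_mem (Or.inr ⟨rfl, hpos, hx.2⟩)] with t ht
        have := hmax ht
        simp only [Set.mem_ofPred_eq] at this
        simpa [hk, hxz] using this.trans_eq hxz.symm
      exact ⟨r - 1 * m, by linarith, hr.sub (.affine 1 x m 0)⟩
  obtain ⟨r, hr0, hr⟩ := hright
  obtain ⟨t, ht, hmem, htpos⟩ := (hr.and ((Inward.eventually_mem
    (Or.inl ⟨rfl, hx.1, hxl⟩)).and self_mem_nhdsWithin)).exists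
  have htpos : 0 < t := htpos
  have h1 : k (x + 1 * t) ≤ k z := hmax hmem
  -- A nonnegative forward slope produces a maximum point beyond the last one.
  have h2 : k (x + 1 * t) = k z := le_antisymm h1 (by rw [ht, hxz]; nlinarith)
  have h3 := hgreatest ⟨hmem, h2⟩
  linarith

namespace IsRational

variable {f : Γ.Point → ℝ} [Fintype E]

theorem add_slopeFwd_mul_len_le (hf : Γ.IsRational f) {e : E}
    (hpos : ∀ t, 0 ≤ Γ.ord f (.inner e t)) :
    f (.vertex (Γ.src e)) + Γ.slopeFwd f e 0 * Γ.len e ≤ f (.vertex (Γ.tgt e)) := by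
  have := (hf.hasOutSlope_slopeFwd le_rfl (Γ.len_pos e)).add_mul_le_of_convex (Γ.len_pos e)
    (hf.2 e).continuousOn fun x hx => ⟨_, _, hf.hasOutSlope_slopeFwd hx.1.le hx.2,
      hf.hasOutSlope_slopeBwd hx.1 hx.2.le, hpos ⟨x, hx⟩⟩
  simpa only [param_zero, param_len] using this

theorem add_slopeBwd_mul_len_le (hf : Γ.IsRational f) {e : E}
    (hpos : ∀ t, 0 ≤ Γ.ord f (.inner e t)) :
    f (.vertex (Γ.tgt e)) + Γ.slopeBwd f e (Γ.len e) * Γ.len e ≤ f (.vertex (Γ.src e)) := by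
  set l := Γ.len e with hl
  have hl0 : 0 < l := Γ.len_pos e
  -- The reflection `s ↦ l - s` exchanges the two directions and reduces the claim to the forward
  -- case.
  have hrefl {σ x m : ℝ} (h : HasOutSlope (-σ) (fun s => f (Γ.param e s)) (l - x) m) :
      HasOutSlope σ (fun s => f (Γ.param e (l - s))) x m := by
    filter_upwards [h] with t ht
    rw [← ht]
    congr 2; ring
  have hcont : ContinuousOn (fun s => f (Γ.param e (l - s))) (Set.Icc 0 l) :=
    (hf.2 e).continuousOn.comp (f := fun s => l - s) (by fun_prop)
      fun s hs => ⟨by linarith [hs.2], by linarith [hs.1]⟩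
  have h0 := hrefl (x := 0) (by simpa using hf.hasOutSlope_slopeBwd hl0 le_rfl)
  have := h0.add_mul_le_of_convex hl0 hcont fun x hx => by
    have h1 : 0 < l - x := sub_pos.2 hx.2
    have h2 : l - x < l := by linarith [hx.1]
    refine ⟨_, _, hrefl (hf.hasOutSlope_slopeBwd h1 h2.le),
      hrefl (by simpa using hf.hasOutSlope_slopeFwd h1.le h2), ?_⟩
    rw [add_comm]
    exact hpos ⟨l - x, h1, h2⟩
  simpa only [sub_zero, sub_self, hl, param_zero, param_len] using this

end IsRational

end MetricGraph

/-! ### Linear systems of vertex divisors on the graph and on the metric graph -/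

namespace Multigraph

variable {V E : Type*} (G : Multigraph V E)

theorem toMetricDivisor_vertex (D : Divisor V) (v : V) : G.toMetricDivisor D (.vertex v) = D v :=
  Finsupp.mapDomain_apply (fun _ _ h => MetricGraph.Point.vertex.inj h) D v

theorem toMetricDivisor_inner (D : Divisor V) (e : E)
    (t : Set.Ioo 0 (G.toMetricGraph.len e)) : G.toMetricDivisor D (.inner e t) = 0 :=
  Finsupp.mapDomain_of_notMem_range _ _ (by rintro ⟨v, hv⟩; cases hv)

theorem toMetricDivisor_sub (D D' : Divisor V) :
    G.toMetricDivisor (D - D') = G.toMetricDivisor D - G.toMetricDivisor D' :=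
  map_sub (Finsupp.mapDomain.addMonoidHom _) D D'

theorem toMetricDivisor_nonneg {D : Divisor V} (hD : 0 ≤ D) : 0 ≤ G.toMetricDivisor D := by
  intro p
  cases p with
  | vertex v => rw [toMetricDivisor_vertex]; exact hD v
  | inner e t => rw [toMetricDivisor_inner]; rfl

theorem deg_toMetricDivisor (D : Divisor V) :
    Divisor.deg (G.toMetricDivisor D) = Divisor.deg D :=
  Finsupp.sum_mapDomain_index (fun _ => rfl) (fun _ _ _ => rfl)

variable [Fintype E]

theorem linearSystem_nonempty_iff [Finite V] (D : Divisor V) :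
    (Divisor.linearSystem G.LinEquiv D).Nonempty ↔ ∃ f : V → ℤ, ∀ v, 0 ≤ D v + G.divAt f v := by
  constructor
  · rintro ⟨F, hF, f, h⟩
    refine ⟨f, fun v => ?_⟩
    rw [← h v]
    simpa using hF v
  · rintro ⟨f, h⟩
    exact ⟨D + Finsupp.equivFunOnFinite.symm (G.divAt f), h, f, fun v => by simp⟩

theorem linearSystem_toMetricDivisor_nonempty_iff [Finite V] (D : Divisor V) :
    (Divisor.linearSystem G.toMetricGraph.LinEquiv (G.toMetricDivisor D)).Nonempty ↔
      (Divisor.linearSystem G.LinEquiv D).Nonempty := by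
  classical
  rw [linearSystem_nonempty_iff, MetricGraph.linearSystem_nonempty_iff]
  constructor
  · rintro ⟨f, hf, hpos⟩
    -- The sign reconciles the conventions: `divAt` sums `f v - f w`, whereas an outgoing slope is
    -- modelled on `f w - f v`.
    refine ⟨fun v => -⌊f (.vertex v)⌋, fun v => ?_⟩
    have hinner (e : E) (t) : 0 ≤ G.toMetricGraph.ord f (.inner e t) := by
      have := hpos (.inner e t)
      rwa [toMetricDivisor_inner, Int.cast_zero, zero_add] at this
    -- As `s` is an integer and the edge has length `1`, `a + s ≤ b` survives taking floors.
    have hfloor {a b s : ℝ} (h : ∃ m : ℤ, s = m) (hle : a + s * 1 ≤ b) :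
        s ≤ ((-⌊a⌋ - -⌊b⌋ : ℤ) : ℝ) := by
      obtain ⟨m, rfl⟩ := h
      have := Int.floor_mono hle
      rw [mul_one, Int.floor_add_intCast] at this
      exact_mod_cast (by linarith : m ≤ -⌊a⌋ - -⌊b⌋)
    have hv := hpos (.vertex v)
    rw [toMetricDivisor_vertex] at hv
    have hord : G.toMetricGraph.ord f (.vertex v) ≤
        (G.divAt (fun v => -⌊f (.vertex v)⌋) v : ℝ) := by
      rw [divAt, Int.cast_sum]
      refine Finset.sum_le_sum fun e _ => ?_
      rw [Int.cast_add]
      refine add_le_add ?_ ?_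
      · change (if G.src e = v then _ else _) ≤ _
        split_ifs with h
        · obtain ⟨m, hm, -⟩ := hf.exists_slopeFwd_eq (e := e) le_rfl one_pos
          have := hf.add_slopeFwd_mul_len_le (hinner e)
          subst h
          exact hfloor ⟨m, hm⟩ this
        · simp
      · change (if G.tgt e = v then _ else _) ≤ _
        split_ifs with h
        · obtain ⟨m, hm, -⟩ := hf.exists_slopeBwd_eq (e := e) one_pos le_rfl
          have := hf.add_slopeBwd_mul_len_le (hinner e)
          subst h
          exact hfloor ⟨m, hm⟩ this
        · simp
    exact_mod_cast hv.trans (add_le_add_right hord _)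
  · rintro ⟨f, hpos⟩
    -- Linear interpolation of `-f`: inner orders vanish, and vertex orders are those of `divAt f`.
    set φ : V → ℝ := fun v => -f v with hφ
    set ψ : E → ℝ → ℝ := fun e t => ((f (G.src e) - f (G.tgt e) : ℤ) : ℝ) * t + φ (G.src e)
      with hψ
    have h0 (e : E) : ψ e 0 = φ (G.src e) := by simp [hψ]
    have h1 (e : E) : ψ e (G.toMetricGraph.len e) = φ (G.tgt e) := by
      simp [hψ, hφ, toMetricGraph, sub_eq_add_neg]
    have hfwd (e : E) {t : ℝ} (ht0 : 0 ≤ t) (ht1 : t < 1) :=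
      MetricGraph.slopeFwd_ofEdges (Γ := G.toMetricGraph) (h0 e) (h1 e) ht0 ht1
        (MetricGraph.HasOutSlope.affine _ _ _ _)
    have hbwd (e : E) {t : ℝ} (ht0 : 0 < t) (ht1 : t ≤ 1) :=
      MetricGraph.slopeBwd_ofEdges (Γ := G.toMetricGraph) (h0 e) (h1 e) ht0 ht1
        (MetricGraph.HasOutSlope.affine _ _ _ _)
    refine ⟨G.toMetricGraph.ofEdges φ ψ,
      MetricGraph.isRational_ofEdges h0 h1 fun e => MetricGraph.isIntegralPL_affine _ _ _,
      fun p => ?_⟩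
    cases p with
    | vertex v =>
      have hord : G.toMetricGraph.ord (G.toMetricGraph.ofEdges φ ψ) (.vertex v) = G.divAt f v := by
        rw [divAt, Int.cast_sum]
        refine Finset.sum_congr rfl fun e _ => ?_
        rw [hfwd e le_rfl one_pos]
        change _ + (if G.tgt e = v then
          G.toMetricGraph.slopeBwd (G.toMetricGraph.ofEdges φ ψ) e 1 else 0) = _
        rw [hbwd e one_pos le_rfl]
        change (if G.src e = v then _ else _) + _ = _
        by_cases hs : G.src e = v <;> by_cases ht : G.tgt e = v <;> simp [hs, ht]
      rw [hord, toMetricDivisor_vertex]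
      exact_mod_cast hpos v
    | inner e t =>
      rw [MetricGraph.ord, hfwd e t.2.1.le t.2.2, hbwd e t.2.1 t.2.2.le, toMetricDivisor_inner]
      simp

end Multigraph

/-! ### Moving two chips towards each other on an edge -/

namespace MetricGraph

variable {V E : Type*} {Γ : MetricGraph V E}

/-- The function on the line that vanishes off `[a, b]`, and on `[a, b]` falls with slope `-1` from
both ends down to `-d`. -/
noncomputable def trough (a b d t : ℝ) : ℝ := max (-d) (max (min 0 (a - t)) (min 0 (t - b)))

section trough

variable {a b d t : ℝ}

theorem isIntegralPL_trough {l : ℝ} (hl : 0 ≤ l) (a b d : ℝ) : IsIntegralPL l (trough a b d) := by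
  have hconst (c : ℝ) : IsIntegralPL l fun _ => c := by simpa using isIntegralPL_affine l 0 c
  refine (hconst (-d)).max hl (((hconst 0).min hl ?_).max hl ((hconst 0).min hl ?_))
  · convert isIntegralPL_affine l (-1) a using 2
    push_cast; ring
  · simpa [sub_eq_add_neg] using isIntegralPL_affine l 1 (-b)

theorem trough_of_le (hd : 0 ≤ d) (h : t ≤ a) : trough a b d t = 0 := by
  simp [trough, h, hd]

theorem trough_of_ge (hd : 0 ≤ d) (h : b ≤ t) : trough a b d t = 0 := by
  simp [trough, h, hd]

theorem neg_le_trough : -d ≤ trough a b d t := le_max_left _ _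

theorem sub_le_trough_left (h : a ≤ t) : a - t ≤ trough a b d t :=
  le_max_of_le_right (le_max_of_le_left (le_min (by linarith) le_rfl))

theorem sub_le_trough_right (h : t ≤ b) : t - b ≤ trough a b d t :=
  le_max_of_le_right (le_max_of_le_right (le_min (by linarith) le_rfl))

theorem trough_cases (ha : a ≤ t) (hb : t ≤ b) :
    trough a b d t = -d ∨ trough a b d t = a - t ∨ trough a b d t = t - b := by
  rw [trough, min_eq_right (by linarith), min_eq_right (by linarith)]
  rcases max_choice (-d) (max (a - t) (t - b)) with h | h <;> rw [h]
  · exact Or.inl rfl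
  · exact Or.inr (max_choice _ _)

variable {σ r s : ℝ}

theorem HasOutSlope.trough_of_left (hd : 0 ≤ d) (h : t < a) (hr : HasOutSlope σ (trough a b d) t r) :
    0 ≤ r := by
  refine hr.le_of_eventually_le ?_
  have hlim : Tendsto (fun s => t + σ * s) (𝓝[>] 0) (𝓝 t) :=
    (Continuous.tendsto' (by fun_prop) 0 t (by simp)).mono_left nhdsWithin_le_nhds
  filter_upwards [hlim.eventually (gt_mem_nhds h)] with s hs
  rw [trough_of_le hd h.le, trough_of_le hd hs.le]; simp

theorem HasOutSlope.trough_of_right (hd : 0 ≤ d) (h : b < t)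
    (hr : HasOutSlope σ (trough a b d) t r) : 0 ≤ r := by
  refine hr.le_of_eventually_le ?_
  have hlim : Tendsto (fun s => t + σ * s) (𝓝[>] 0) (𝓝 t) :=
    (Continuous.tendsto' (by fun_prop) 0 t (by simp)).mono_left nhdsWithin_le_nhds
  filter_upwards [hlim.eventually (lt_mem_nhds h)] with s hs
  rw [trough_of_ge hd h.le, trough_of_ge hd hs.le]; simp

theorem HasOutSlope.trough_fwd_left (hd : 0 ≤ d) (hr : HasOutSlope 1 (trough a b d) a r) :
    -1 ≤ r := by
  refine hr.le_of_eventually_le ?_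
  filter_upwards [eventually_lt_nhdsGT_zero one_pos] with s hs
  rw [trough_of_le hd le_rfl]
  linarith [sub_le_trough_left (b := b) (d := d) (show a ≤ a + 1 * s by linarith [hs.1])]

theorem HasOutSlope.trough_bwd_left (hd : 0 ≤ d) (hr : HasOutSlope (-1) (trough a b d) a r) :
    0 ≤ r := by
  refine hr.le_of_eventually_le ?_
  filter_upwards [eventually_lt_nhdsGT_zero one_pos] with s hs
  rw [trough_of_le hd le_rfl, trough_of_le hd (by linarith [hs.1])]
  simp

theorem HasOutSlope.trough_bwd_right (hd : 0 ≤ d) (hr : HasOutSlope (-1) (trough a b d) b r) :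
    -1 ≤ r := by
  refine hr.le_of_eventually_le ?_
  filter_upwards [eventually_lt_nhdsGT_zero one_pos] with s hs
  rw [trough_of_ge hd le_rfl]
  linarith [sub_le_trough_right (a := a) (d := d) (show b + -1 * s ≤ b by linarith [hs.1])]

theorem HasOutSlope.trough_fwd_right (hd : 0 ≤ d) (hr : HasOutSlope 1 (trough a b d) b r) :
    0 ≤ r := by
  refine hr.le_of_eventually_le ?_
  filter_upwards [eventually_lt_nhdsGT_zero one_pos] with s hs
  rw [trough_of_ge hd le_rfl, trough_of_ge hd (by linarith [hs.1])]
  simp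

theorem HasOutSlope.trough_of_eq_neg (h : trough a b d t = -d)
    (hr : HasOutSlope σ (trough a b d) t r) : 0 ≤ r := by
  refine hr.le_of_eventually_le (Eventually.of_forall fun s => ?_)
  rw [h, zero_mul, add_zero]
  exact neg_le_trough

theorem HasOutSlope.trough_of_eq_left (ha : a < t) (h : trough a b d t = a - t)
    (hr : HasOutSlope σ (trough a b d) t r) : -σ ≤ r := by
  refine hr.le_of_eventually_le ?_
  have hlim : Tendsto (fun s => t + σ * s) (𝓝[>] 0) (𝓝 t) :=
    (Continuous.tendsto' (by fun_prop) 0 t (by simp)).mono_left nhdsWithin_le_nhds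
  filter_upwards [hlim.eventually (lt_mem_nhds ha)] with s hs
  rw [h]
  linarith [sub_le_trough_left (b := b) (d := d) hs.le]

theorem HasOutSlope.trough_of_eq_right (hb : t < b) (h : trough a b d t = t - b)
    (hr : HasOutSlope σ (trough a b d) t r) : σ ≤ r := by
  refine hr.le_of_eventually_le ?_
  have hlim : Tendsto (fun s => t + σ * s) (𝓝[>] 0) (𝓝 t) :=
    (Continuous.tendsto' (by fun_prop) 0 t (by simp)).mono_left nhdsWithin_le_nhds
  filter_upwards [hlim.eventually (gt_mem_nhds hb)] with s hs
  rw [h]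
  linarith [sub_le_trough_right (a := a) (d := d) hs.le]

/-- The value at `t` lies on the floor or on a wall, and `trough` stays above that line nearby; the
two slope bounds from the line add up to zero. -/
theorem HasOutSlope.trough_of_mem (ha : a < t) (hb : t < b)
    (hr : HasOutSlope 1 (trough a b d) t r) (hs : HasOutSlope (-1) (trough a b d) t s) :
    0 ≤ r + s := by
  rcases trough_cases (d := d) ha.le hb.le with h | h | h
  · linarith [hr.trough_of_eq_neg h, hs.trough_of_eq_neg h]
  · linarith [hr.trough_of_eq_left ha h, hs.trough_of_eq_left ha h]
  · linarith [hr.trough_of_eq_right hb h, hs.trough_of_eq_right hb h]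

/-- At this depth `t` is a foot of a wall: it lies both on the floor and on the wall from its nearer
end, whose upward slope contributes the `1`. -/
theorem HasOutSlope.trough_of_min (ha : a < t) (hb : t < b)
    (hr : HasOutSlope 1 (trough a b (min (t - a) (b - t))) t r)
    (hs : HasOutSlope (-1) (trough a b (min (t - a) (b - t))) t s) : 1 ≤ r + s := by
  have h : trough a b (min (t - a) (b - t)) t = -min (t - a) (b - t) := by
    rw [trough, min_eq_right (by linarith : a - t ≤ 0), min_eq_right (by linarith : t - b ≤ 0),
      max_eq_left]
    exact max_le (by linarith [min_le_left (t - a) (b - t)])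
      (by linarith [min_le_right (t - a) (b - t)])
  have hr0 := hr.trough_of_eq_neg h
  have hs0 := hs.trough_of_eq_neg h
  rcases min_choice (t - a) (b - t) with hd | hd
  · linarith [hs.trough_of_eq_left ha (by linarith)]
  · linarith [hr.trough_of_eq_right hb (by linarith)]

end trough

open Classical in
/-- Two chips at the points `a < b` of an edge can be moved so that one arrives at a given point in
between. -/
theorem exists_chip_move [Fintype E] (e : E) {a b p : ℝ} (ha : 0 ≤ a) (hap : a < p) (hpb : p < b)
    (hb : b ≤ Γ.len e) :
    ∃ h, Γ.IsRational h ∧ ∀ q, (if q = Γ.param e p then (1 : ℝ) else 0) -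
      (if q = Γ.param e a then 1 else 0) - (if q = Γ.param e b then 1 else 0) ≤ Γ.ord h q := by
  -- Both chips travel the distance `d`, so the one starting nearer to `p` arrives there.
  set d := min (p - a) (b - p) with hd
  have hd0 : 0 ≤ d := le_min (by linarith) (by linarith)
  set ψ : E → ℝ → ℝ := fun e' => if e' = e then trough a b d else fun _ => 0 with hψ
  have hψe : ψ e = trough a b d := if_pos rfl
  have hψe' {e' : E} (h : e' ≠ e) : ψ e' = fun _ => 0 := if_neg h
  have hψ0 (e' : E) : ψ e' 0 = 0 := by
    by_cases h : e' = e
    · rw [h, hψe, trough_of_le hd0 ha]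
    · rw [hψe' h]
  have hψ1 (e' : E) : ψ e' (Γ.len e') = 0 := by
    by_cases h : e' = e
    · rw [h, hψe, trough_of_ge hd0 hb]
    · rw [hψe' h]
  have hPL (e' : E) : IsIntegralPL (Γ.len e') (ψ e') := by
    by_cases h : e' = e
    · rw [h, hψe]; exact isIntegralPL_trough (Γ.len_pos e).le _ _ _
    · rw [hψe' h]; simpa using isIntegralPL_affine (Γ.len e') 0 0
  set h := Γ.ofEdges (fun _ => 0) ψ with hh
  have hfwd {t : ℝ} (h0 : 0 ≤ t) (h1 : t < Γ.len e) :
      HasOutSlope 1 (trough a b d) t (Γ.slopeFwd h e t) := by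
    obtain ⟨m, hm⟩ := (hPL e).exists_hasOutSlope (Or.inl ⟨rfl, h0, h1⟩)
    rw [slopeFwd_ofEdges (hψ0 e) (hψ1 e) h0 h1 hm, ← hψe]
    exact hm
  have hbwd {t : ℝ} (h0 : 0 < t) (h1 : t ≤ Γ.len e) :
      HasOutSlope (-1) (trough a b d) t (Γ.slopeBwd h e t) := by
    obtain ⟨m, hm⟩ := (hPL e).exists_hasOutSlope (Or.inr ⟨rfl, h0, h1⟩)
    rw [slopeBwd_ofEdges (hψ0 e) (hψ1 e) h0 h1 hm, ← hψe]
    exact hm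
  have hfwd' {e' : E} (he : e' ≠ e) {t : ℝ} (h0 : 0 ≤ t) (h1 : t < Γ.len e') :
      Γ.slopeFwd h e' t = 0 :=
    slopeFwd_ofEdges (hψ0 e') (hψ1 e') h0 h1 (by rw [hψe' he]; exact .const _ _ _)
  have hbwd' {e' : E} (he : e' ≠ e) {t : ℝ} (h0 : 0 < t) (h1 : t ≤ Γ.len e') :
      Γ.slopeBwd h e' t = 0 :=
    slopeBwd_ofEdges (hψ0 e') (hψ1 e') h0 h1 (by rw [hψe' he]; exact .const _ _ _)
  have hpmem : p ∈ Set.Ioo 0 (Γ.len e) := ⟨ha.trans_lt hap, hpb.trans_le hb⟩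
  have hind (P : Prop) : (0 : ℝ) ≤ if P then 1 else 0 := by split_ifs <;> norm_num
  refine ⟨h, isRational_ofEdges hψ0 hψ1 hPL, fun q => ?_⟩
  have hinda := hind (q = Γ.param e a)
  have hindb := hind (q = Γ.param e b)
  cases q with
  | vertex v =>
    rw [if_neg (by rw [Γ.param_of_mem hpmem]; exact fun h => by cases h), ord,
      Finset.sum_eq_single e]
    · have h1 : -(if Point.vertex v = Γ.param e a then (1 : ℝ) else 0) ≤
          if Γ.src e = v then Γ.slopeFwd h e 0 else 0 := by
        by_cases hv : Γ.src e = v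
        · rw [if_pos hv]
          have hr := hfwd le_rfl (Γ.len_pos e)
          -- The vertex loses a chip only if the trough starts there; otherwise the function is flat
          -- near it.
          rcases ha.eq_or_lt with rfl | ha
          · rw [if_pos (by rw [param_zero, hv])]
            exact hr.trough_fwd_left hd0
          · linarith [hr.trough_of_left hd0 ha]
        · rw [if_neg hv]; linarith
      have h2 : -(if Point.vertex v = Γ.param e b then (1 : ℝ) else 0) ≤
          if Γ.tgt e = v then Γ.slopeBwd h e (Γ.len e) else 0 := by
        by_cases hv : Γ.tgt e = v
        · rw [if_pos hv]
          have hs := hbwd (Γ.len_pos e) le_rfl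
          rcases hb.eq_or_lt with rfl | hb
          · rw [if_pos (by rw [param_len, hv])]
            exact hs.trough_bwd_right hd0
          · linarith [hs.trough_of_right hd0 hb]
        · rw [if_neg hv]; linarith
      linarith
    · intro e' _ he
      rw [hfwd' he le_rfl (Γ.len_pos e'), hbwd' he (Γ.len_pos e') le_rfl]
      simp
    · simp
  | inner e' t =>
    by_cases he : e' = e
    · subst he
      have hr := hfwd t.2.1.le t.2.2
      have hs := hbwd t.2.1 t.2.2.le
      rw [ord]
      by_cases htp : (t : ℝ) = p
      · rw [if_pos (by rw [← htp, Γ.param_of_mem t.2])]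
        rw [hd, ← htp] at hr hs
        linarith [hr.trough_of_min (htp ▸ hap) (htp ▸ hpb) hs]
      rw [if_neg (by
        rw [Γ.param_of_mem hpmem]
        intro h
        cases h
        exact htp rfl)]
      rcases lt_trichotomy (t : ℝ) a with hta | hta | hta
      · linarith [hr.trough_of_left hd0 hta, hs.trough_of_left hd0 hta]
      · rw [if_pos (by rw [← hta, Γ.param_of_mem t.2])]
        rw [hta] at hr hs ⊢
        linarith [hr.trough_fwd_left hd0, hs.trough_bwd_left hd0]
      rcases lt_trichotomy (t : ℝ) b with htb | htb | htb
      · linarith [hr.trough_of_mem hta htb hs]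
      · rw [if_pos (by rw [← htb, Γ.param_of_mem t.2] : Point.inner e' t = Γ.param e' b)]
        rw [htb] at hr hs ⊢
        linarith [hr.trough_fwd_right hd0, hs.trough_bwd_right hd0]
      · linarith [hr.trough_of_right hd0 htb, hs.trough_of_right hd0 htb]
    · rw [ord, hfwd' he t.2.1.le t.2.2, hbwd' he t.2.1 t.2.2.le,
        if_neg (by rw [Γ.param_of_mem hpmem]; intro h; cases h; exact he rfl)]
      linarith

/-! ### Sections through the inner points of an edge -/

theorem exists_first_last_zero {l p : ℝ} {δ : ℝ → ℝ} (hδ : ContinuousOn δ (Set.Icc 0 l))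
    (hp : p ∈ Set.Icc 0 l) (h : δ p = 0) :
    (∃ a ∈ Set.Icc 0 p, δ a = 0 ∧ ∀ t ∈ Set.Icc 0 l, t < a → δ t ≠ 0) ∧
      ∃ b ∈ Set.Icc p l, δ b = 0 ∧ ∀ t ∈ Set.Icc 0 l, b < t → δ t ≠ 0 := by
  have hK : IsCompact (Set.Icc 0 l ∩ δ ⁻¹' {0}) :=
    isCompact_Icc.of_isClosed_subset
      (hδ.preimage_isClosed_of_isClosed isClosed_Icc isClosed_singleton) Set.inter_subset_left
  obtain ⟨a, ⟨ha, haz⟩, hal⟩ := hK.exists_isLeast ⟨p, hp, h⟩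
  obtain ⟨b, ⟨hb, hbz⟩, hbg⟩ := hK.exists_isGreatest ⟨p, hp, h⟩
  exact ⟨⟨a, ⟨ha.1, hal ⟨hp, h⟩⟩, haz, fun t ht hta h0 => (hal ⟨ht, h0⟩).not_gt hta⟩,
    b, ⟨hbg ⟨hp, h⟩, hb.2⟩, hbz, fun t ht hbt h0 => (hbg ⟨ht, h0⟩).not_gt hbt⟩

namespace IsRational

variable [Fintype E] {f₁ f₂ : Γ.Point → ℝ} {e : E}

/-- The maximum of two sections gains a chip at a point where they meet with distinct slopes. -/
theorem one_le_ord_max_inner (h₁ : Γ.IsRational f₁) (h₂ : Γ.IsRational f₂) {c : ℝ}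
    {t : Set.Ioo 0 (Γ.len e)} (hc₁ : 0 ≤ c + Γ.ord f₁ (.inner e t))
    (hc₂ : 0 ≤ c + Γ.ord f₂ (.inner e t)) (heq : f₁ (.inner e t) = f₂ (.inner e t))
    (hne : Γ.slopeBwd f₁ e t ≠ Γ.slopeBwd f₂ e t ∨ Γ.slopeFwd f₁ e t ≠ Γ.slopeFwd f₂ e t) :
    1 ≤ c + Γ.ord (fun p => Max.max (f₁ p) (f₂ p)) (.inner e t) := by
  rw [← Γ.param_of_mem t.2] at heq
  have hg := h₁.max h₂
  have hle₁ (p) : f₁ p ≤ Max.max (f₁ p) (f₂ p) := le_max_left _ _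
  have hle₂ (p) : f₂ p ≤ Max.max (f₁ p) (f₂ p) := le_max_right _ _
  have e₁ : f₁ (Γ.param e t) = Max.max (f₁ (Γ.param e t)) (f₂ (Γ.param e t)) := by simp [heq]
  have e₂ : f₂ (Γ.param e t) = Max.max (f₁ (Γ.param e t)) (f₂ (Γ.param e t)) := by simp [heq]
  have F₁ := h₁.slopeFwd_le_of_touch hg hle₁ t.2.1.le t.2.2 e₁
  have F₂ := h₂.slopeFwd_le_of_touch hg hle₂ t.2.1.le t.2.2 e₂
  have B₁ := h₁.slopeBwd_le_of_touch hg hle₁ t.2.1 t.2.2.le e₁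
  have B₂ := h₂.slopeBwd_le_of_touch hg hle₂ t.2.1 t.2.2.le e₂
  have hgap {x y : ℝ} (hx : ∃ m : ℤ, x = m) (hy : ∃ m : ℤ, y = m) (hxy : x ≠ y) :
      x + 1 ≤ y ∨ y + 1 ≤ x := by
    obtain ⟨m, rfl⟩ := hx
    obtain ⟨n, rfl⟩ := hy
    rcases lt_or_gt_of_ne (show m ≠ n by exact_mod_cast hxy) with h | h
    · exact Or.inl (by exact_mod_cast h)
    · exact Or.inr (by exact_mod_cast h)
  obtain ⟨m₁, hm₁, -⟩ := h₁.exists_slopeFwd_eq t.2.1.le t.2.2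
  obtain ⟨m₂, hm₂, -⟩ := h₂.exists_slopeFwd_eq t.2.1.le t.2.2
  obtain ⟨n₁, hn₁, -⟩ := h₁.exists_slopeBwd_eq t.2.1 t.2.2.le
  obtain ⟨n₂, hn₂, -⟩ := h₂.exists_slopeBwd_eq t.2.1 t.2.2.le
  simp only [ord] at hc₁ hc₂ ⊢
  rcases hne with hne | hne
  -- Compare the maximum with the function of smaller slope: integrality gains at least `1` in this
  -- direction, and the other direction loses nothing.
  · rcases hgap ⟨n₁, hn₁⟩ ⟨n₂, hn₂⟩ hne with h | h <;> linarith
  · rcases hgap ⟨m₁, hm₁⟩ ⟨m₂, hm₂⟩ hne with h | h <;> linarith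

open Classical in
/-- If the linear system of `c` has members through both ends of an edge, it has one through each
inner point of the edge. -/
theorem exists_section_inner (hloop : Γ.src e ≠ Γ.tgt e) {c : Γ.Point → ℝ}
    (h₁ : Γ.IsRational f₁) (h₂ : Γ.IsRational f₂)
    (hc₁ : ∀ q, (if q = .vertex (Γ.src e) then (1 : ℝ) else 0) ≤ c q + Γ.ord f₁ q)
    (hc₂ : ∀ q, (if q = .vertex (Γ.tgt e) then (1 : ℝ) else 0) ≤ c q + Γ.ord f₂ q)
    (p : Set.Ioo 0 (Γ.len e)) :
    ∃ f, Γ.IsRational f ∧ ∀ q, (if q = .inner e p then (1 : ℝ) else 0) ≤ c q + Γ.ord f q := by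
  -- Adding a constant changes no order.
  wlog heq : f₁ (.inner e p) = f₂ (.inner e p) generalizing f₂
  · refine this (h₂.add_const (f₁ (.inner e p) - f₂ (.inner e p))) (fun q => ?_) (by simp)
    rw [h₂.ord_add_const]
    exact hc₂ q
  have hind (P : Prop) : (0 : ℝ) ≤ if P then 1 else 0 := by split_ifs <;> norm_num
  have hpos₁ (q) : 0 ≤ c q + Γ.ord f₁ q := (hind _).trans (hc₁ q)
  have hpos₂ (q) : 0 ≤ c q + Γ.ord f₂ q := (hind _).trans (hc₂ q)
  set g : Γ.Point → ℝ := fun q => Max.max (f₁ q) (f₂ q) with hgdef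
  have hg : Γ.IsRational g := h₁.max h₂
  have hord₁ {q} (hq : f₂ q ≤ f₁ q) : Γ.ord f₁ q ≤ Γ.ord g q :=
    h₁.ord_le_of_touch hg (fun _ => le_max_left _ _) (max_eq_left hq).symm
  have hord₂ {q} (hq : f₁ q ≤ f₂ q) : Γ.ord f₂ q ≤ Γ.ord g q :=
    h₂.ord_le_of_touch hg (fun _ => le_max_right _ _) (max_eq_right hq).symm
  have hpos (q) : 0 ≤ c q + Γ.ord g q := by
    rcases le_total (f₂ q) (f₁ q) with hq | hq
    · linarith [hpos₁ q, hord₁ hq]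
    · linarith [hpos₂ q, hord₂ hq]
  obtain ⟨⟨a, ha, ha0, halt⟩, b, hb, hb0, hbgt⟩ :=
    exists_first_last_zero (δ := fun t => f₁ (Γ.param e t) - f₂ (Γ.param e t)) (l := Γ.len e) (p := p)
      ((h₁.2 e).continuousOn.sub (h₂.2 e).continuousOn) ⟨p.2.1.le, p.2.2.le⟩
      (by simp [Γ.param_of_mem p.2, heq])
  have hal : a < Γ.len e := ha.2.trans_lt p.2.2
  have hb0' : 0 < b := p.2.1.trans_le hb.1
  have hchipa : 1 ≤ c (Γ.param e a) + Γ.ord g (Γ.param e a) := by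
    -- If `a = 0`, the maximum inherits the chip of `f₁` at the source. Otherwise the backward
    -- slopes at `a` must differ, since equal ones would make `f₁` and `f₂` agree just before `a`.
    rcases ha.1.eq_or_lt with rfl | hapos
    · have := hc₁ (Γ.param e 0)
      rw [if_pos (Γ.param_zero e)] at this
      linarith [hord₁ (sub_nonneg.1 ha0.ge)]
    · rw [sub_eq_zero, Γ.param_of_mem ⟨hapos, hal⟩] at ha0
      rw [Γ.param_of_mem ⟨hapos, hal⟩]
      refine h₁.one_le_ord_max_inner h₂ (hpos₁ _) (hpos₂ _) ha0 (Or.inl fun hs => ?_)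
      obtain ⟨t, ht₁, ht₂, hmem, htpos⟩ := ((h₁.hasOutSlope_slopeBwd hapos hal.le).and
        ((h₂.hasOutSlope_slopeBwd hapos hal.le).and ((Inward.eventually_mem
          (Or.inr ⟨rfl, hapos, hal.le⟩)).and (eventually_lt_nhdsGT_zero one_pos)))).exists
      refine halt _ hmem (by linarith [htpos.1]) ?_
      beta_reduce at ht₁ ht₂
      rw [ht₁, ht₂, Γ.param_of_mem ⟨hapos, hal⟩, ha0]
      simp only at hs
      rw [hs, sub_self]
  have hchipb : 1 ≤ c (Γ.param e b) + Γ.ord g (Γ.param e b) := by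
    rcases hb.2.eq_or_lt with rfl | hbl
    · have := hc₂ (Γ.param e (Γ.len e))
      rw [if_pos (Γ.param_len e)] at this
      linarith [hord₂ (sub_nonpos.1 hb0.le)]
    · rw [sub_eq_zero, Γ.param_of_mem ⟨hb0', hbl⟩] at hb0
      rw [Γ.param_of_mem ⟨hb0', hbl⟩]
      refine h₁.one_le_ord_max_inner h₂ (hpos₁ _) (hpos₂ _) hb0 (Or.inr fun hs => ?_)
      obtain ⟨t, ht₁, ht₂, hmem, htpos⟩ := ((h₁.hasOutSlope_slopeFwd hb0'.le hbl).and
        ((h₂.hasOutSlope_slopeFwd hb0'.le hbl).and ((Inward.eventually_mem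
          (Or.inl ⟨rfl, hb0'.le, hbl⟩)).and (eventually_lt_nhdsGT_zero one_pos)))).exists
      refine hbgt _ hmem (by linarith [htpos.1]) ?_
      beta_reduce at ht₁ ht₂
      rw [ht₁, ht₂, Γ.param_of_mem ⟨hb0', hbl⟩, hb0]
      simp only at hs
      rw [hs, sub_self]
  have hdone (hchip : 1 ≤ c (Γ.param e p) + Γ.ord g (Γ.param e p)) :
      ∃ f, Γ.IsRational f ∧ ∀ q, (if q = .inner e p then (1 : ℝ) else 0) ≤ c q + Γ.ord f q := by
    refine ⟨g, hg, fun q => ?_⟩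
    split_ifs with hq
    · rwa [hq, ← Γ.param_of_mem p.2]
    · exact hpos q
  -- If `p` is itself the first or the last point of agreement, it already carries a chip.
  rcases ha.2.eq_or_lt with rfl | hap
  · exact hdone hchipa
  rcases hb.1.eq_or_lt with hpb | hpb
  · exact hdone (by rwa [hpb])
  obtain ⟨h, hh, hord⟩ := exists_chip_move (Γ := Γ) e ha.1 hap hpb hb.2
  refine ⟨fun q => g q + h q, hg.add hh, fun q => ?_⟩
  have hq := hord q
  rw [hg.ord_add hh, ← Γ.param_of_mem p.2]
  -- The move consumes two chips, so they must lie at distinct points. On a loop, `a = 0` and `b =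
  -- len e` would be one vertex with only one chip guaranteed.
  have hab : Γ.param e a ≠ Γ.param e b := by
    intro hab
    rcases ha.1.eq_or_lt with rfl | hapos <;> rcases hb.2.eq_or_lt with rfl | hbl
    · rw [param_zero, param_len] at hab
      exact hloop (Point.vertex.inj hab)
    · rw [param_zero, Γ.param_of_mem ⟨hb0', hbl⟩] at hab
      cases hab
    · rw [param_len, Γ.param_of_mem ⟨hapos, hal⟩] at hab
      cases hab
    · rw [Γ.param_of_mem ⟨hb0', hbl⟩, Γ.param_of_mem ⟨hapos, hal⟩] at hab
      simp only [Point.inner.injEq, heq_eq_eq, true_and] at hab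
      exact (hap.trans hpb).ne (congrArg Subtype.val hab)
  have hposq := hpos q
  by_cases hqa : q = Γ.param e a
  · rw [if_pos hqa, if_neg (show q ≠ Γ.param e b from hqa ▸ hab)] at hq
    rw [← hqa] at hchipa
    linarith
  · rw [if_neg hqa] at hq
    by_cases hqb : q = Γ.param e b
    · rw [if_pos hqb] at hq
      rw [← hqb] at hchipb
      linarith
    · rw [if_neg hqb] at hq
      linarith

end IsRational

end MetricGraph

/-! ### Degrees of effective divisors -/

namespace Divisor

variable {X : Type*}

theorem deg_add (D D' : Divisor X) : deg (D + D') = deg D + deg D' :=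
  Finsupp.sum_add_index' (fun _ => rfl) (fun _ _ _ => rfl)

theorem deg_single (p : X) (n : ℤ) : deg (Finsupp.single p n) = n :=
  Finsupp.sum_single_index rfl

theorem deg_nonneg {D : Divisor X} (hD : 0 ≤ D) : 0 ≤ deg D :=
  Finset.sum_nonneg fun p _ => hD p

theorem exists_eq_add_single {D : Divisor X} (hD : 0 ≤ D) (h0 : D ≠ 0) :
    ∃ (p : X) (D' : Divisor X), 0 ≤ D' ∧ D = D' + Finsupp.single p 1 := by
  classical
  obtain ⟨p, hp⟩ := Finsupp.ne_iff.1 h0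
  refine ⟨p, D - Finsupp.single p 1, fun q => ?_, by simp⟩
  have h1 : 0 ≤ D q := hD q
  have h2 : 0 ≤ D p := hD p
  have h3 : D p ≠ 0 := hp
  simp only [Finsupp.coe_zero, Pi.zero_apply, Finsupp.sub_apply, Finsupp.single_apply]
  split_ifs with h
  · subst h; omega
  · omega

theorem eq_zero_of_deg_eq_zero {D : Divisor X} (hD : 0 ≤ D) (h : deg D = 0) : D = 0 := by
  by_contra h0
  obtain ⟨p, D', hD', rfl⟩ := exists_eq_add_single hD h0
  rw [deg_add, deg_single] at h
  linarith [deg_nonneg hD']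

end Divisor

/-! ### The vertices determine the rank -/

namespace MetricGraph

variable {V E : Type*} [Finite V] [Fintype E] {Γ : MetricGraph V E}

open Classical in
theorem linearSystem_sub_single_nonempty_iff (D : Divisor Γ.Point) (p : Γ.Point) :
    (Divisor.linearSystem Γ.LinEquiv (D - Finsupp.single p 1)).Nonempty ↔
      ∃ f, Γ.IsRational f ∧ ∀ q, (if q = p then (1 : ℝ) else 0) ≤ D q + Γ.ord f q := by
  rw [linearSystem_nonempty_iff]
  refine exists_congr fun f => and_congr_right fun _ => forall_congr' fun q => ?_
  rw [Finsupp.sub_apply, Finsupp.single_apply, Int.cast_sub, Int.cast_ite, Int.cast_one,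
    Int.cast_zero, ← sub_nonneg (b := ite _ _ _), eq_comm (a := p)]
  ring_nf

/-- A divisor on a loopless metric graph whose linear system has a member through each vertex has
one through each point. -/
theorem linearSystem_sub_single_nonempty (hloop : Γ.Loopless) {D : Divisor Γ.Point}
    (h : ∀ v, (Divisor.linearSystem Γ.LinEquiv (D - Finsupp.single (.vertex v) 1)).Nonempty)
    (p : Γ.Point) : (Divisor.linearSystem Γ.LinEquiv (D - Finsupp.single p 1)).Nonempty := by
  cases p with
  | vertex v => exact h v
  | inner e t =>
    obtain ⟨f₁, h₁, hc₁⟩ := (linearSystem_sub_single_nonempty_iff _ _).1 (h (Γ.src e))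
    obtain ⟨f₂, h₂, hc₂⟩ := (linearSystem_sub_single_nonempty_iff _ _).1 (h (Γ.tgt e))
    exact (linearSystem_sub_single_nonempty_iff _ _).2
      (h₁.exists_section_inner (hloop e) h₂ hc₁ hc₂ t)

/-- The vertices of a loopless metric graph form a rank-determining set. -/
theorem linearSystem_sub_nonempty_of_vertices (hloop : Γ.Loopless) (n : ℕ) {D : Divisor Γ.Point}
    (hD : ∀ F : Divisor V, 0 ≤ F → Divisor.deg F = n →
      (Divisor.linearSystem Γ.LinEquiv (D - F.mapDomain .vertex)).Nonempty)
    {F : Divisor Γ.Point} (hF : 0 ≤ F) (hdeg : Divisor.deg F = n) :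
    (Divisor.linearSystem Γ.LinEquiv (D - F)).Nonempty := by
  induction n generalizing D F with
  | zero =>
    rw [Divisor.eq_zero_of_deg_eq_zero hF hdeg]
    simpa using hD 0 le_rfl rfl
  | succ n ih =>
    have hF0 : F ≠ 0 := by
      rintro rfl
      have h0 : Divisor.deg (0 : Divisor Γ.Point) = 0 := rfl
      rw [h0] at hdeg
      omega
    obtain ⟨p, F', hF', rfl⟩ := Divisor.exists_eq_add_single hF hF0
    rw [Divisor.deg_add, Divisor.deg_single] at hdeg
    rw [show D - (F' + Finsupp.single p 1) = D - Finsupp.single p 1 - F' by abel]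
    -- Induction applied to `D - p` leaves only vertex divisors `A` of degree `n` to subtract. In
    -- `(D - A) - p` the point `p` may then be replaced by a vertex `v`, and `A + v` is covered by
    -- `hD`.
    refine ih (fun A hA hAdeg => ?_) hF' (by push_cast at hdeg; linarith)
    rw [sub_right_comm]
    refine linearSystem_sub_single_nonempty hloop (fun v => ?_) p
    have hsingle : 0 ≤ (Finsupp.single v 1 : Divisor V) := Finsupp.single_nonneg.2 zero_le_one
    have := hD (A + Finsupp.single v 1) (add_nonneg hA hsingle)
      (by rw [Divisor.deg_add, Divisor.deg_single, hAdeg]; push_cast; rfl)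
    rwa [Finsupp.mapDomain_add, Finsupp.mapDomain_single, ← sub_sub] at this

end MetricGraph

/-! ### Comparison of the two ranks -/

namespace Multigraph

variable {V E : Type*} [Fintype V] [Fintype E] (G : Multigraph V E)

theorem sum_divAt (f : V → ℤ) : ∑ v, G.divAt f v = 0 := by
  classical
  simp only [divAt]
  rw [Finset.sum_comm]
  refine Finset.sum_eq_zero fun e _ => ?_
  rw [Finset.sum_add_distrib, Finset.sum_ite_eq, Finset.sum_ite_eq]
  simp

theorem deg_eq_of_linEquiv {D D' : Divisor V} (h : G.LinEquiv D D') :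
    Divisor.deg D = Divisor.deg D' := by
  obtain ⟨f, hf⟩ := h
  have := G.sum_divAt f
  simp only [← hf, Finsupp.sub_apply, Finset.sum_sub_distrib] at this
  simp only [Divisor.deg, Finsupp.sum_fintype _ (fun _ n => n) (fun _ => rfl)]
  linarith

theorem emptyingDegrees_nonempty [Nonempty V] (D : Divisor V) :
    (Divisor.emptyingDegrees G.LinEquiv D).Nonempty := by
  obtain ⟨v⟩ := ‹Nonempty V›
  -- Large enough to make the degree of `D - n (v)` negative, and nonnegative so that `n (v)` is
  -- effective.
  set n := max 0 (Divisor.deg D + 1)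
  refine ⟨_, Finsupp.single v n, Finsupp.single_nonneg.2 (le_max_left _ _), ?_, rfl⟩
  refine Set.eq_empty_of_forall_notMem fun F ⟨hF, hequiv⟩ => ?_
  have h1 := G.deg_eq_of_linEquiv hequiv
  have h2 := Divisor.deg_add (D - Finsupp.single v n) (Finsupp.single v n)
  rw [sub_add_cancel, Divisor.deg_single] at h2
  linarith [Divisor.deg_nonneg hF, le_max_right 0 (Divisor.deg D + 1)]

theorem emptyingDegrees_toMetricDivisor (hloop : G.Loopless) (D : Divisor V) :
    Divisor.emptyingDegrees G.toMetricGraph.LinEquiv (G.toMetricDivisor D) =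
      Divisor.emptyingDegrees G.LinEquiv D := by
  have hiff (F : Divisor V) :
      Divisor.linearSystem G.toMetricGraph.LinEquiv (G.toMetricDivisor D - G.toMetricDivisor F) =
        ∅ ↔ Divisor.linearSystem G.LinEquiv (D - F) = ∅ := by
    rw [← toMetricDivisor_sub, ← Set.not_nonempty_iff_eq_empty,
      linearSystem_toMetricDivisor_nonempty_iff, Set.not_nonempty_iff_eq_empty]
  ext n
  constructor
  · rintro ⟨F, hF, hempty, rfl⟩
    by_contra hn
    -- `F` itself need not live on vertices; if no vertex divisor of the same degree emptied the
    -- system, `F` could not either.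
    refine (Set.not_nonempty_iff_eq_empty.2 hempty)
      (MetricGraph.linearSystem_sub_nonempty_of_vertices hloop (Divisor.deg F).toNat
        (fun A hA hdeg => ?_) hF (Int.toNat_of_nonneg (Divisor.deg_nonneg hF)).symm)
    rw [Int.toNat_of_nonneg (Divisor.deg_nonneg hF)] at hdeg
    refine Set.nonempty_iff_ne_empty.2 fun h => hn ⟨A, hA, (hiff A).1 h, hdeg⟩
  · rintro ⟨F, hF, hempty, rfl⟩
    exact ⟨G.toMetricDivisor F, G.toMetricDivisor_nonneg hF, (hiff F).2 hempty,
      G.deg_toMetricDivisor F⟩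

end Multigraph

theorem mainTheorem3 {V E : Type*} [Fintype V] [Fintype E] (G : Multigraph V E)
    (hconn : G.Connected) (hloop : G.Loopless) (D : Divisor V) :
    (Divisor.emptyingDegrees G.LinEquiv D).Nonempty ∧
    (Divisor.emptyingDegrees G.toMetricGraph.LinEquiv (G.toMetricDivisor D)).Nonempty ∧
    G.rank D = G.toMetricGraph.rank (G.toMetricDivisor D) := by
  have : Nonempty V := hconn.nonempty
  have hne := G.emptyingDegrees_nonempty D
  rw [Multigraph.rank, MetricGraph.rank, Divisor.rank, Divisor.rank,
    G.emptyingDegrees_toMetricDivisor hloop]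
  exact ⟨hne, hne, rfl⟩
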